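/- Graphs are finite and simple. For a positive integer $\Delta$ let $\mathcal F(\Delta)$ be the set of graphs of maximum degree at most $\Delta$. A consistent port numbering of $G$ is an involution $p$ of the set of ports $\{(v,i) : v\in V,\ 1\le i\le \deg v\}$ such that for every edge $\{u,v\}$ there are $i,j$ with $p(u,i)=(v,j)$; write $p(v,i)=(p_{\mathrm{tail}}(v,i),p_{\mathrm n}(v,i))$ for $i\le\deg v$. A CPNGNN for $\mathcal F(\Delta)$ starts from node features $z^{(1)}_v=x_v$, computes, for an arbitrary number $L$ of layers with arbitrary embedding dimensions $d_2,\dots,d_{L+1}$ and arbitrary real weight matrices $W^{(l)}\in\mathbb R^{d_{l+1}\times(d_l+\Delta(d_l+1))}$, $$z_v^{(l+1)}=\mathrm{ReLU}\bigl(W^{(l)}\,\mathrm{Concat}(z_v^{(l)},z^{(l)}_{p_{\mathrm{tail}}(v,1)},p_{\mathrm n}(v,1),\dots,z^{(l)}_{p_{\mathrm{tail}}(v,\Delta)},p_{\mathrm n}(v,\Delta))\bigr),\qquad l=1,\dots,L,$$ where the entries belonging to $i>\deg v$ are zero, and labels $v$ with $\operatorname{argmax}_{y\in\{0,1\}}\mathrm{MLP}(z_v^{(L+1)})_y$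 (the smaller index in case of a tie), where $\mathrm{MLP}$ is a multilayer perceptron with ReLU activation, arbitrary depth and widths, and two outputs. A weak 2-colouring of $G$ is a map $c:V\to\{0,1\}$ such that every node has a neighbour of the other colour. The feature vector of $v$ is the one-hot vector of $\deg v\in\{0,\dots,\Delta\}$ followed by $c(v)$. For real $\alpha$, say that CPNGNNs can solve $\alpha$-approximation of the minimum dominating set problem on $\mathcal F(\Delta)$ with weak 2-colourings if there are parameters (number of layers, dimensions, weights, MLP) such that for every $G\in\mathcal F(\Delta)$, every consistent port numbering of $G$ and every weak 2-colouring of $G$, the set $D$ of nodes labelled $1$ is a dominating set of $G$ with $|D|\le\alpha\,\gamma(G)$, where $\gamma(G)$ is the minimum size of a dominating set of $G$. Theorem. For every integer $\Delta\ge1$, CPNGNNs can solve $\frac{\Delta+1}{2}$-approximation of the minimum dominating set problem on $\mathcal F(\Delta)$ with weak 2-colourings, and for no real $\alpha<\frac{\Delta+1}{2}$ can they solve $\alpha$-approximation on $\mathcal F(\Delta)$ with weak 2-colourings. -/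

import Mathlib

namespace GNN

variable {V : Type*} [Fintype V]

/-! ### Ports and consistent port numberings -/

/-- The ports `(v, i)`, `i ∈ [deg v]`, of a graph. The `i`-th port of `v` (`i = 1, …, deg v`) is
represented by the element `i - 1` of `Fin (deg v)`. -/
abbrev Port (G : SimpleGraph V) [DecidableRel G.Adj] : Type _ :=
  Σ v : V, Fin (G.degree v)

/-- A consistent port numbering of `G`: a map `p` from ports to ports such that for every edge
`{u, v}` some port of `u` is mapped to a port of `v`, and such that `p` is an involution. -/
structure ConsistentPortNumbering (G : SimpleGraph V) [DecidableRel G.Adj] where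
  /-- the map on ports -/
  toFun : Port G → Port G
  edge : ∀ u v : V, G.Adj u v →
    ∃ (i : Fin (G.degree u)) (j : Fin (G.degree v)), toFun ⟨u, i⟩ = ⟨v, j⟩
  consistent : Function.Involutive toFun

namespace ConsistentPortNumbering

variable {G : SimpleGraph V} [DecidableRel G.Adj] (p : ConsistentPortNumbering G)

/-- The port that sends messages to the port of `v` with (zero-based) index `i`; `none` is the
special symbol for an index out of range. As `p` is an involution, the unique port that `p` maps
to `(v, i)` is `p (v, i)`, see `source_eq_some_iff`. -/
def source (v : V) (i : ℕ) : Option (Port G) :=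
  if h : i < G.degree v then some (p.toFun ⟨v, ⟨i, h⟩⟩) else none

theorem source_eq_some_iff (v : V) (i : ℕ) (q : Port G) :
    p.source v i = some q ↔ ∃ h : i < G.degree v, p.toFun q = ⟨v, ⟨i, h⟩⟩ := by
  unfold source
  split_ifs with h
  · constructor
    · intro hq
      refine ⟨h, ?_⟩
      rw [← Option.some.inj hq]
      exact p.consistent _
    · rintro ⟨_, hq⟩
      rw [← hq, p.consistent q]
  · simp [h]

/-- `p_tail (v, i)`: the node that sends messages to the port of `v` with zero-based index `i`. -/
def tail (v : V) (i : ℕ) : Option V :=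
  (p.source v i).map fun q => q.1

/-- `p_n (v, i)`: the number (in `{1, …, deg (p_tail (v, i))}`) of the port of the node
`p_tail (v, i)` that sends messages to the port of `v` with zero-based index `i`. -/
def num (v : V) (i : ℕ) : Option ℕ :=
  (p.source v i).map fun q => (q.2 : ℕ) + 1

end ConsistentPortNumbering

/-! ### CPNGNNs -/

/-- The rectified linear unit. -/
def relu (x : ℝ) : ℝ := max x 0

/-- The coordinates of
`Concat (z_v, z_{p_tail (v, 1)}, p_n (v, 1), …, z_{p_tail (v, Δ)}, p_n (v, Δ))`
for embeddings of dimension `d`; there are `d + Δ (d + 1)` of them. -/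
abbrev ConcatIndex (Δ d : ℕ) : Type := Fin d ⊕ (Fin Δ × (Fin d ⊕ Unit))

/-- `Concat (z_v, z_{p_tail (v, 1)}, p_n (v, 1), …, z_{p_tail (v, Δ)}, p_n (v, Δ))`. The special
symbol for an index out of range is fed to the network as zero (padding); the numbers of existing
ports are positive. -/
def concat {G : SimpleGraph V} [DecidableRel G.Adj] (p : ConsistentPortNumbering G)
    (Δ : ℕ) {d : ℕ} (z : V → Fin d → ℝ) (v : V) : ConcatIndex Δ d → ℝ
  | Sum.inl k => z v k
  | Sum.inr (i, Sum.inl k) => (p.tail v i).elim 0 fun u => z u k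
  | Sum.inr (i, Sum.inr _) => (p.num v i).elim 0 fun j => (j : ℝ)

/-- The weight matrices `W⁽¹⁾, …, W⁽ᴸ⁾` of the message passing layers, for any number `L` of
layers and any dimensions `d = d₁, d₂, …, d_{L+1} = e`; here
`W⁽ˡ⁾` is a real `d_{l+1} × (d_l + Δ (d_l + 1))` matrix. -/
inductive Layers (Δ : ℕ) : ℕ → ℕ → Type
  | nil (d : ℕ) : Layers Δ d d
  | cons {d d' e : ℕ} (W : Matrix (Fin d') (ConcatIndex Δ d) ℝ) (rest : Layers Δ d' e) :
      Layers Δ d e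

/-- The embeddings computed by the message passing layers: each layer replaces `z_v` by
`ReLU (W Concat (z_v, z_{p_tail (v, 1)}, p_n (v, 1), …))`, at all nodes `v` simultaneously. -/
noncomputable def Layers.eval {G : SimpleGraph V} [DecidableRel G.Adj]
    (p : ConsistentPortNumbering G) {Δ : ℕ} :
    {d e : ℕ} → Layers Δ d e → (V → Fin d → ℝ) → V → Fin e → ℝ
  | _, _, .nil _, z => z
  | _, _, .cons W rest, z =>
      rest.eval p fun v k => relu ((W.mulVec (concat p Δ z v)) k)

/-- The parameters of a multilayer perceptron with input dimension `d`, output dimension `e`, and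
any number of hidden layers, of any widths. -/
inductive MLP : ℕ → ℕ → Type
  | output {d e : ℕ} (W : Matrix (Fin e) (Fin d) ℝ) (b : Fin e → ℝ) : MLP d e
  | hidden {d d' e : ℕ} (W : Matrix (Fin d') (Fin d) ℝ) (b : Fin d' → ℝ) (rest : MLP d' e) :
      MLP d e

/-- The function computed by a multilayer perceptron: affine maps, with ReLU activation in the
hidden layers. -/
noncomputable def MLP.eval : {d e : ℕ} → MLP d e → (Fin d → ℝ) → Fin e → ℝ
  | _, _, .output W b, x => W.mulVec x + b
  | _, _, .hidden W b rest, x => rest.eval fun k => relu ((W.mulVec x + b) k)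

/-- The (first, if there are several) index of a maximal coordinate. -/
noncomputable def argmax {k : ℕ} (z : Fin (k + 1) → ℝ) : Fin (k + 1) :=
  (Finset.univ.filter fun i => ∀ j, z j ≤ z i).min' <| by
    obtain ⟨i, hi⟩ := Finite.exists_max z
    exact ⟨i, by simpa using hi⟩

/-- The parameters `θ` of a CPNGNN for graphs of maximum degree at most `Δ`, with node features
of dimension `d₁` and label set `{0, …, k}`. -/
structure CPNGNN (Δ d₁ k : ℕ) where
  /-- the dimension of the embeddings after the last message passing layer -/
  dim : ℕ
  /-- the weights of the message passing layers -/
  layers : Layers Δ d₁ dim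
  /-- the parameters of the final multilayer perceptron -/
  mlp : MLP dim (k + 1)

/-- The label that a CPNGNN computes at the node `v` of a graph with a consistent port numbering
`p` and node features `x`. -/
noncomputable def CPNGNN.label {Δ d₁ k : ℕ} (θ : CPNGNN Δ d₁ k) {G : SimpleGraph V}
    [DecidableRel G.Adj] (p : ConsistentPortNumbering G) (x : V → Fin d₁ → ℝ) (v : V) :
    Fin (k + 1) :=
  argmax (θ.mlp.eval (θ.layers.eval p x v))

/-! ### Weak 2-colourings and node features -/

/-- A weak 2-colouring: every node has a neighbour of the other colour. -/
def IsWeakTwoColoring (G : SimpleGraph V) (c : V → Fin 2) : Prop :=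
  ∀ v, ∃ u, G.Adj v u ∧ c v ≠ c u

/-- The feature vector of a node: the one-hot vector of its degree (in `{0, …, Δ}`), followed by
its colour. -/
def feature (Δ : ℕ) (G : SimpleGraph V) [DecidableRel G.Adj] (c : V → Fin 2) (v : V) :
    Fin (Δ + 1 + 1) → ℝ :=
  Fin.snoc (α := fun _ => ℝ) (fun k : Fin (Δ + 1) => if (k : ℕ) = G.degree v then 1 else 0)
    ((c v : ℕ) : ℝ)

/-! ### Minimum dominating sets -/

/-- A dominating set: every node is in the set or has a neighbour in it. -/
def IsDominating (G : SimpleGraph V) (D : Finset V) : Prop :=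
  ∀ v, v ∈ D ∨ ∃ u ∈ D, G.Adj v u

/-- The size of a minimum dominating set. -/
noncomputable def dominationNumber (G : SimpleGraph V) : ℕ :=
  sInf {k : ℕ | ∃ D : Finset V, IsDominating G D ∧ D.card = k}

/-- `D` is an `α`-approximation of the minimum dominating set of `G`. -/
def IsMDSApprox (G : SimpleGraph V) (α : ℝ) (D : Finset V) : Prop :=
  IsDominating G D ∧ (D.card : ℝ) ≤ α * dominationNumber G

/-- With the degree and the colour of a weak 2-colouring as node features, some CPNGNN computes
an `α`-approximation of the minimum dominating set on all graphs of maximum degree at most `Δ`: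
there are parameters `θ` such that, for every such graph, every consistent port numbering and
every weak 2-colouring, the nodes labelled `1` form an `α`-approximation. -/
def CanApproxMDS (Δ : ℕ) (α : ℝ) : Prop :=
  ∃ θ : CPNGNN Δ (Δ + 1 + 1) 1,
    ∀ (n : ℕ) (G : SimpleGraph (Fin n)) [DecidableRel G.Adj], (∀ v, G.degree v ≤ Δ) →
      ∀ (p : ConsistentPortNumbering G) (c : Fin n → Fin 2), IsWeakTwoColoring G c →
        IsMDSApprox G α (Finset.univ.filter fun v => θ.label p (feature Δ G c) v = 1)

end GNN

namespace GNN

/-! ### Layer stacks and the functions they compute -/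

/-! Upper bound: every node selects a partner of the other colour, the one behind its first suitable
port. From this selection alone, `IsCenter` picks out a dominating set in which each centre is
selected by some non-centre, so it has at most half of the n nodes; and n ≤ (Δ+1)γ because closed
neighbourhoods have at most Δ+1 elements. The rule is a Boolean combination of the colour and of
conditions "selected by a node satisfying P". It therefore suffices that predicates computable by
layers are closed under these operations; for the last one, `exists_partner_eq_iff` makes essential
use of the received port numbers.

Lower bound: in K_{Δ+1,Δ+1} minus a perfect matching, the ports can be numbered so that each leads
to a port of the same number on the other side. With the sides as colours, all nodes of a side get
the same label (`CPNGNN.label_eq_of_color_eq`), so a dominating output contains a whole side, Δ+1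
nodes, while γ ≤ 2. -/

/-- The composition of two stacks of message passing layers. -/
def Layers.append {Δ : ℕ} : {d e f : ℕ} → Layers Δ d e → Layers Δ e f → Layers Δ d f
  | _, _, _, .nil _, M => M
  | _, _, _, .cons W rest, M => .cons W (rest.append M)

theorem Layers.eval_append {V : Type*} [Fintype V] {G : SimpleGraph V} [DecidableRel G.Adj]
    (p : ConsistentPortNumbering G) {Δ d e f : ℕ} (L : Layers Δ d e) (M : Layers Δ e f)
    (z : V → Fin d → ℝ) : (L.append M).eval p z = M.eval p (L.eval p z) := by
  induction L with
  | nil d => rfl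
  | cons W rest ih => exact ih M _

/-- The data to which a CPNGNN is applied. -/
structure Input (Δ : ℕ) where
  /-- the number of nodes -/
  n : ℕ
  /-- the graph -/
  G : SimpleGraph (Fin n)
  /-- adjacency is decidable -/
  dec : DecidableRel G.Adj
  degree_le : ∀ v, G.degree v ≤ Δ
  /-- the port numbering -/
  p : ConsistentPortNumbering G
  /-- the colouring -/
  c : Fin n → Fin 2
  weak : IsWeakTwoColoring G c

attribute [instance] Input.dec

/-- Real functions on the nodes of all inputs. -/
abbrev NodeFn (Δ : ℕ) : Type := (I : Input Δ) → Fin I.n → ℝ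

namespace NodeFn

variable {Δ : ℕ}

/-- A coordinate of the output of a stack of layers. -/
noncomputable def coord {e : ℕ} (L : Layers Δ (Δ + 1 + 1) e) (k : Fin e) : NodeFn Δ :=
  fun I v => L.eval I.p (feature Δ I.G I.c) v k

/-- A coordinate of the concatenated messages formed from the output of a stack of layers. -/
noncomputable def message {e : ℕ} (L : Layers Δ (Δ + 1 + 1) e) (k : ConcatIndex Δ e) : NodeFn Δ :=
  fun I v => concat I.p Δ (L.eval I.p (feature Δ I.G I.c)) v k

/-- The linear combinations of the outputs of a stack of layers. -/
noncomputable def outSpan {e : ℕ} (L : Layers Δ (Δ + 1 + 1) e) : Submodule ℝ (NodeFn Δ) :=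
  Submodule.span ℝ (Set.range (coord L))

/-- The linear combinations of the messages. -/
noncomputable def messageSpan {e : ℕ} (L : Layers Δ (Δ + 1 + 1) e) : Submodule ℝ (NodeFn Δ) :=
  Submodule.span ℝ (Set.range (message L))

/-- The pointwise rectified linear unit. -/
noncomputable def rectify (g : NodeFn Δ) : NodeFn Δ := fun I v => relu (g I v)

/-- The value at the neighbour behind a port, zero if there is none. -/
def pull (i : Fin Δ) : NodeFn Δ →ₗ[ℝ] NodeFn Δ where
  toFun g := fun I v => (I.p.tail v i).elim 0 (g I)
  map_add' g h := by
    funext I v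
    simp only [Pi.add_apply]
    cases I.p.tail v i <;> simp
  map_smul' a g := by
    funext I v
    simp only [Pi.smul_apply, RingHom.id_apply]
    cases I.p.tail v i <;> simp

/-- The number of the port behind a port, zero if there is none. -/
def portNum (i : Fin Δ) : NodeFn Δ := fun I v => (I.p.num v i).elim 0 fun j => (j : ℝ)

/-- Every layer ends in a ReLU; a signed value passes through it as the difference of two rectified
ones. -/
theorem rectify_sub_rectify_neg (g : NodeFn Δ) : rectify g - rectify (-g) = g := by
  funext I v
  simp only [rectify, relu, Pi.sub_apply, Pi.neg_apply]
  rcases le_total (g I v) 0 with h | h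
  · rw [max_eq_right h, max_eq_left (by linarith)]; ring
  · rw [max_eq_left h, max_eq_right (by linarith)]; ring

theorem outSpan_le_messageSpan {e : ℕ} (L : Layers Δ (Δ + 1 + 1) e) :
    outSpan L ≤ messageSpan L := by
  refine Submodule.span_mono ?_
  rintro _ ⟨k, rfl⟩
  exact ⟨Sum.inl k, rfl⟩

theorem pull_mem_messageSpan {e : ℕ} (L : Layers Δ (Δ + 1 + 1) e) (i : Fin Δ) {g : NodeFn Δ}
    (hg : g ∈ outSpan L) : pull i g ∈ messageSpan L := by
  have h : outSpan L ≤ (messageSpan L).comap (pull i) := by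
    refine Submodule.span_le.2 ?_
    rintro _ ⟨k, rfl⟩
    exact Submodule.subset_span ⟨Sum.inr (i, Sum.inl k), rfl⟩
  exact h hg

theorem portNum_mem_messageSpan {e : ℕ} (L : Layers Δ (Δ + 1 + 1) e) (i : Fin Δ) :
    portNum i ∈ messageSpan L :=
  Submodule.subset_span ⟨Sum.inr (i, Sum.inr ()), rfl⟩

/-- The coefficients of each `h i` over the messages form one row of the new weight matrix. -/
theorem exists_layer {e : ℕ} (L : Layers Δ (Δ + 1 + 1) e) {ι : Type} [Fintype ι]
    (h : ι → NodeFn Δ) (hh : ∀ i, h i ∈ messageSpan L) :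
    ∃ (e' : ℕ) (L' : Layers Δ (Δ + 1 + 1) e'), ∀ i, rectify (h i) ∈ outSpan L' := by
  have hw : ∀ i, ∃ w : ConcatIndex Δ e → ℝ, ∑ j, w j • message L j = h i := fun i =>
    (Submodule.mem_span_range_iff_exists_fun ℝ).1 (hh i)
  choose w hw using hw
  let E := Fintype.equivFin ι
  refine ⟨Fintype.card ι,
    L.append (.cons (Matrix.of fun k => w (E.symm k)) (.nil _)), fun i => ?_⟩
  refine Submodule.subset_span ⟨E i, ?_⟩
  funext I v
  simp only [coord, Layers.eval_append, Layers.eval, rectify, ← hw i]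
  congr 1
  simp [Matrix.mulVec, dotProduct, message, Finset.sum_apply]

/-- The added layer also carries each old coordinate and its negative, so nothing known before is
lost. -/
theorem exists_extension {e : ℕ} (L : Layers Δ (Δ + 1 + 1) e) {h : NodeFn Δ}
    (hh : h ∈ messageSpan L) :
    ∃ (e' : ℕ) (L' : Layers Δ (Δ + 1 + 1) e'), outSpan L ≤ outSpan L' ∧
      rectify h ∈ outSpan L' := by
  have hc (k : Fin e) : coord L k ∈ messageSpan L :=
    outSpan_le_messageSpan L (Submodule.subset_span ⟨k, rfl⟩)
  obtain ⟨e', L', h'⟩ := exists_layer L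
    (Sum.elim (coord L) (Sum.elim (fun k => -coord L k) fun _ : Unit => h)) (by
      rintro (k | k | _)
      · exact hc k
      · exact neg_mem (hc k)
      · exact hh)
  refine ⟨e', L', Submodule.span_le.2 ?_, h' (Sum.inr (Sum.inr ()))⟩
  rintro _ ⟨k, rfl⟩
  rw [← rectify_sub_rectify_neg (coord L k)]
  exact sub_mem (h' (Sum.inl k)) (h' (Sum.inr (Sum.inl k)))

/-- Every stack of layers that still knows the features can be extended to one that has `g` among
the linear combinations of its outputs. -/
def Computable (g : NodeFn Δ) : Prop :=
  ∀ (e : ℕ) (L : Layers Δ (Δ + 1 + 1) e), outSpan (.nil (Δ + 1 + 1)) ≤ outSpan L →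
    ∃ (e' : ℕ) (L' : Layers Δ (Δ + 1 + 1) e'), outSpan L ≤ outSpan L' ∧ g ∈ outSpan L'

/-! ### Closure properties of computable node functions -/

namespace Computable

theorem exists_layers {g : NodeFn Δ} (hg : Computable g) :
    ∃ (e : ℕ) (L : Layers Δ (Δ + 1 + 1) e) (w : Fin e → ℝ), ∑ k, w k • coord L k = g := by
  obtain ⟨e, L, -, h⟩ := hg _ (.nil _) le_rfl
  exact ⟨e, L, (Submodule.mem_span_range_iff_exists_fun ℝ).1 h⟩

/-- Since `Computable` starts from an arbitrary stack, the layers for `h` can be run on top of those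
for `g`, with `g` kept in the span. -/
theorem add {g h : NodeFn Δ} (hg : Computable g) (hh : Computable h) : Computable (g + h) := by
  intro e L hL
  obtain ⟨e₁, L₁, h₁, hg₁⟩ := hg e L hL
  obtain ⟨e₂, L₂, h₂, hh₂⟩ := hh e₁ L₁ (hL.trans h₁)
  exact ⟨e₂, L₂, h₁.trans h₂, add_mem (h₂ hg₁) hh₂⟩

theorem smul (a : ℝ) {g : NodeFn Δ} (hg : Computable g) : Computable (a • g) := by
  intro e L hL
  obtain ⟨e₁, L₁, h₁, hg₁⟩ := hg e L hL
  exact ⟨e₁, L₁, h₁, Submodule.smul_mem _ a hg₁⟩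

theorem neg {g : NodeFn Δ} (hg : Computable g) : Computable (-g) := by
  simpa using hg.smul (-1)

theorem sub {g h : NodeFn Δ} (hg : Computable g) (hh : Computable h) : Computable (g - h) := by
  simpa [sub_eq_add_neg] using hg.add hh.neg

theorem feature_coord (k : Fin (Δ + 1 + 1)) :
    Computable (Δ := Δ) fun I v => feature Δ I.G I.c v k :=
  fun e L hL => ⟨e, L, le_rfl, hL (Submodule.subset_span ⟨k, rfl⟩)⟩

theorem rectify {g : NodeFn Δ} (hg : Computable g) : Computable (NodeFn.rectify g) := by
  intro e L hL
  obtain ⟨e₁, L₁, h₁, hg₁⟩ := hg e L hL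
  obtain ⟨e₂, L₂, h₂, hg₂⟩ := exists_extension L₁ (outSpan_le_messageSpan L₁ hg₁)
  exact ⟨e₂, L₂, h₁.trans h₂, hg₂⟩

theorem pull (i : Fin Δ) {g : NodeFn Δ} (hg : Computable g) : Computable (NodeFn.pull i g) := by
  -- A layer delivers only the rectified pull; by linearity of the pull, using `g` and `-g` recovers
  -- the sign.
  have key {g : NodeFn Δ} (hg : Computable g) :
      Computable (NodeFn.rectify (NodeFn.pull i g)) := by
    intro e L hL
    obtain ⟨e₁, L₁, h₁, hg₁⟩ := hg e L hL
    obtain ⟨e₂, L₂, h₂, hg₂⟩ := exists_extension L₁ (pull_mem_messageSpan L₁ i hg₁)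
    exact ⟨e₂, L₂, h₁.trans h₂, hg₂⟩
  rw [← rectify_sub_rectify_neg (NodeFn.pull i g), ← map_neg]
  exact (key hg).sub (key hg.neg)

theorem portNum (i : Fin Δ) : Computable (NodeFn.portNum i) := by
  have h : NodeFn.rectify (NodeFn.portNum i) = NodeFn.portNum i := by
    funext I v
    refine max_eq_left ?_
    unfold NodeFn.portNum
    cases I.p.num v i <;> simp
  intro e L hL
  obtain ⟨e₂, L₂, h₂, hg₂⟩ := exists_extension L (portNum_mem_messageSpan L i)
  exact ⟨e₂, L₂, h₂, h ▸ hg₂⟩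

/-- The layers have no bias; the constant is the sum of the one-hot degree entries. -/
theorem one : Computable (1 : NodeFn Δ) := by
  have h : ∀ s : Finset (Fin (Δ + 1)),
      Computable (∑ k ∈ s, fun I v => feature Δ I.G I.c v k.castSucc : NodeFn Δ) := by
    intro s
    induction s using Finset.induction_on with
    | empty => simpa using (feature_coord (Δ := Δ) 0).smul 0
    | insert a s ha ih =>
      rw [Finset.sum_insert ha]
      exact (feature_coord _).add ih
  convert h Finset.univ
  funext I v
  have hv : I.G.degree v < Δ + 1 := Nat.lt_succ_of_le (I.degree_le v)
  simp only [feature, Finset.sum_apply, Fin.snoc_castSucc, Pi.one_apply]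
  rw [Finset.sum_eq_single (⟨I.G.degree v, hv⟩ : Fin (Δ + 1))]
  · simp
  · intro b _ hb
    rw [if_neg]
    exact fun h => hb (Fin.ext h)
  · simp

end Computable

end NodeFn

/-! ### Computable predicates -/

/-- Predicates on the nodes of all inputs. -/
abbrev NodePred (Δ : ℕ) : Type := (I : Input Δ) → Fin I.n → Prop

namespace NodePred

variable {Δ : ℕ}

open Classical in
/-- The indicator function of a predicate. -/
noncomputable def indicator (P : NodePred Δ) : NodeFn Δ := fun I v => if P I v then 1 else 0

/-- The indicator function is computable. -/
def Computable (P : NodePred Δ) : Prop := NodeFn.Computable P.indicator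

namespace Computable

theorem not {P : NodePred Δ} (hP : Computable P) : Computable fun I v => ¬ P I v := by
  unfold Computable
  convert NodeFn.Computable.one.sub hP
  funext I v
  by_cases h : P I v <;> simp [indicator, h]

theorem and {P Q : NodePred Δ} (hP : Computable P) (hQ : Computable Q) :
    Computable fun I v => P I v ∧ Q I v := by
  unfold Computable
  -- On 0/1 values, conjunction is ReLU(p + q − 1).
  convert ((hP.add hQ).sub NodeFn.Computable.one).rectify
  funext I v
  by_cases h : P I v <;> by_cases h' : Q I v <;>
    simp [indicator, NodeFn.rectify, relu, h, h']

theorem or {P Q : NodePred Δ} (hP : Computable P) (hQ : Computable Q) :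
    Computable fun I v => P I v ∨ Q I v := by
  convert (hP.not.and hQ.not).not using 3
  tauto

theorem const_false : Computable (Δ := Δ) fun _ _ => False := by
  unfold Computable
  convert NodeFn.Computable.one.smul 0
  funext I v
  simp [indicator]

theorem exists_mem {ι : Type*} (s : Finset ι) {P : ι → NodePred Δ} (hP : ∀ i, Computable (P i)) :
    Computable fun I v => ∃ i ∈ s, P i I v := by
  classical
  induction s using Finset.induction_on with
  | empty => simpa using const_false
  | insert a s ha ih =>
    convert (hP a).or ih using 3
    simp

theorem exists_fintype {ι : Type*} [Fintype ι] {P : ι → NodePred Δ}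
    (hP : ∀ i, Computable (P i)) : Computable fun I v => ∃ i, P i I v := by
  simpa using exists_mem Finset.univ hP

theorem color_eq_one : Computable (Δ := Δ) fun I v => I.c v = 1 := by
  unfold Computable
  convert NodeFn.Computable.feature_coord (Fin.last (Δ + 1))
  rename_i I v
  simp only [indicator, feature, Fin.snoc_last]
  have hx : I.c v = 0 ∨ I.c v = 1 := by
    generalize I.c v = x
    revert x
    decide
  rcases hx with h | h <;> simp [h]

theorem pull (i : Fin Δ) {P : NodePred Δ} (hP : Computable P) :
    Computable fun I v => ∃ u, I.p.tail v i = some u ∧ P I u := by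
  unfold Computable
  convert NodeFn.Computable.pull i hP
  funext I v
  simp only [indicator, NodeFn.pull, LinearMap.coe_mk, AddHom.coe_mk]
  rcases Option.eq_none_or_eq_some (I.p.tail v i) with h | ⟨u, h⟩
  · simp [h]
  · have hu : (∃ u, I.p.tail v i = some u ∧ P I u) ↔ P I u := by simp [h]
    refine Eq.trans ?_ (congrArg (Option.elim · 0 (P.indicator I)) h).symm
    by_cases h' : P I u
    · exact (if_pos (hu.2 h')).trans (if_pos h').symm
    · exact (if_neg (mt hu.1 h')).trans (if_neg h').symm

theorem num_eq (i : Fin Δ) (k : ℕ) : Computable (Δ := Δ) fun I v => I.p.num v i = some (k + 1) := by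
  unfold Computable
  have h (a : ℝ) : NodeFn.Computable (NodeFn.rectify (NodeFn.portNum i - a • 1)) :=
    ((NodeFn.Computable.portNum i).sub (NodeFn.Computable.one.smul a)).rectify
  -- The hat function that is 1 at k+1 and 0 at all other integers, as a second difference of ReLUs.
  convert ((h k).sub ((h (k + 1)).smul 2)).add (h (k + 2))
  funext I v
  have key (m : ℕ) : (if m = k + 1 then (1 : ℝ) else 0) =
      max ((m : ℝ) - k) 0 - 2 * max ((m : ℝ) - (k + 1)) 0 + max ((m : ℝ) - (k + 2)) 0 := by
    rcases lt_trichotomy m (k + 1) with hm | hm | hm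
    · have : (m : ℝ) ≤ k := by exact_mod_cast Nat.le_of_lt_succ hm
      rw [if_neg hm.ne, max_eq_right, max_eq_right, max_eq_right] <;> linarith
    · subst hm
      rw [if_pos rfl, max_eq_left, max_eq_right, max_eq_right] <;> push_cast <;> linarith
    · have : (k : ℝ) + 2 ≤ m := by exact_mod_cast hm
      rw [if_neg hm.ne', max_eq_left, max_eq_left, max_eq_left] <;> linarith
  simp only [indicator, NodeFn.rectify, NodeFn.portNum, relu, Pi.add_apply, Pi.sub_apply,
    Pi.smul_apply, Pi.one_apply, smul_eq_mul, mul_one]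
  rcases Option.eq_none_or_eq_some (I.p.num v i) with h' | ⟨m, h'⟩
  -- A missing port is padded with 0, which never equals k+1.
  · simpa [h'] using key 0
  · simpa [h'] using key m

end Computable

/-- A computable predicate is the set of nodes labelled `1` by some CPNGNN. -/
theorem Computable.exists_label {P : NodePred Δ} (hP : Computable P) :
    ∃ θ : CPNGNN Δ (Δ + 1 + 1) 1, ∀ I : Input Δ, ∀ v,
      θ.label I.p (feature Δ I.G I.c) v = 1 ↔ P I v := by
  obtain ⟨e, L, w, hw⟩ := NodeFn.Computable.exists_layers hP
  refine ⟨⟨e, L, .output (Matrix.of ![0, w]) 0⟩, fun I v => ?_⟩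
  have h1 : (Matrix.of ![0, w]).mulVec (L.eval I.p (feature Δ I.G I.c) v) + 0
      = ![0, P.indicator I v] := by
    funext k
    rw [← hw]
    fin_cases k <;>
      simp [dotProduct, NodeFn.coord, Finset.sum_apply]
  simp only [CPNGNN.label, MLP.eval, h1]
  -- Ties go to label 0, hence the strict inequality.
  have harg (x : ℝ) : argmax (k := 1) ![0, x] = 1 ↔ 0 < x := by
    have hmem := Finset.min'_mem
      (Finset.univ.filter fun i : Fin 2 => ∀ j, (![0, x] : Fin 2 → ℝ) j ≤ ![0, x] i)
      (by
        obtain ⟨i, hi⟩ := Finite.exists_max (![0, x] : Fin 2 → ℝ)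
        exact ⟨i, by simpa using hi⟩)
    have hle := Finset.min'_le
      (Finset.univ.filter fun i : Fin 2 => ∀ j, (![0, x] : Fin 2 → ℝ) j ≤ ![0, x] i) 0
    change argmax (k := 1) ![0, x] ∈ _ at hmem
    change _ → argmax (k := 1) ![0, x] ≤ 0 at hle
    generalize argmax (k := 1) ![0, x] = a at hmem hle
    simp only [Finset.mem_filter, Finset.mem_univ, true_and, Fin.forall_fin_two] at hmem hle
    fin_cases a
    · simpa using hmem
    · simpa using hle
  rw [harg]
  by_cases h : P I v <;> simp [indicator, h]

end NodePred

/-! ### Selecting a neighbour of the other colour -/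

/-- The edge condition says only that the ports of `v` reach all neighbours. As there are deg v of
each, counting leaves no port for a non-neighbour. -/
theorem ConsistentPortNumbering.adj {V : Type*} [Fintype V] {G : SimpleGraph V}
    [DecidableRel G.Adj] (p : ConsistentPortNumbering G) (v : V) (i : Fin (G.degree v)) :
    G.Adj v (p.toFun ⟨v, i⟩).1 := by
  classical
  let f : Fin (G.degree v) → V := fun i => (p.toFun ⟨v, i⟩).1
  have hsub : G.neighborFinset v ⊆ Finset.univ.image f := by
    intro u hu
    obtain ⟨i, j, hij⟩ := p.edge v u (by simpa using hu)
    exact Finset.mem_image.2 ⟨i, Finset.mem_univ _, by simp [f, hij]⟩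
  have heq : G.neighborFinset v = Finset.univ.image f :=
    Finset.eq_of_subset_of_card_le hsub
      (Finset.card_image_le.trans (by simp [SimpleGraph.card_neighborFinset_eq_degree]))
  have : f i ∈ G.neighborFinset v := heq ▸ Finset.mem_image_of_mem f (Finset.mem_univ i)
  simpa using this

namespace Input

variable {Δ : ℕ} (I : Input Δ)

/-- The port with index `i` leads to a node of the other colour. -/
def Opposite (v : Fin I.n) (i : ℕ) : Prop := ∃ u, I.p.tail v i = some u ∧ I.c u ≠ I.c v

/-- `i` is the first port that leads to a node of the other colour. -/
def Selects (v : Fin I.n) (i : ℕ) : Prop := I.Opposite v i ∧ ∀ j < i, ¬ I.Opposite v j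

theorem Selects.unique {I : Input Δ} {v : Fin I.n} {i j : ℕ} (hi : I.Selects v i)
    (hj : I.Selects v j) : i = j := by
  rcases lt_trichotomy i j with h | h | h
  · exact absurd hi.1 (hj.2 i h)
  · exact h
  · exact absurd hj.1 (hi.2 j h)

theorem tail_eq_some {v : Fin I.n} {i : ℕ} {u : Fin I.n} (h : I.p.tail v i = some u) :
    I.G.Adj v u ∧ i < I.G.degree v ∧ ∃ (j : ℕ) (_ : j < I.G.degree u),
      I.p.tail u j = some v ∧ I.p.num v i = some (j + 1) ∧ I.p.num u j = some (i + 1) := by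
  obtain ⟨q, hq, rfl⟩ := Option.map_eq_some_iff.1 h
  obtain ⟨hi, hp⟩ := (I.p.source_eq_some_iff v i q).1 hq
  have hq' : I.p.toFun ⟨v, ⟨i, hi⟩⟩ = q := by rw [← hp, I.p.consistent q]
  have hs : I.p.source q.1 q.2 = some ⟨v, ⟨i, hi⟩⟩ :=
    (I.p.source_eq_some_iff _ _ _).2 ⟨q.2.2, hq'⟩
  refine ⟨hq' ▸ I.p.adj v ⟨i, hi⟩, hi, q.2, q.2.2, ?_, ?_, ?_⟩ <;>
    simp [ConsistentPortNumbering.tail, ConsistentPortNumbering.num, hs, hq]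

theorem exists_selects (v : Fin I.n) :
    ∃ u, I.G.Adj v u ∧ I.c u ≠ I.c v ∧ ∃ k : Fin Δ, I.Selects v k ∧ I.p.tail v k = some u := by
  classical
  have hex : ∃ i, I.Opposite v i := by
    obtain ⟨u, hu, hc⟩ := I.weak v
    obtain ⟨i, j, hij⟩ := I.p.edge v u hu
    refine ⟨i, u, ?_, hc.symm⟩
    simp [ConsistentPortNumbering.tail, ConsistentPortNumbering.source, hij]
  obtain ⟨u, hu, hc⟩ := Nat.find_spec hex
  obtain ⟨hadj, hlt, -⟩ := I.tail_eq_some hu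
  exact ⟨u, hadj, hc, ⟨Nat.find hex, hlt.trans_le (I.degree_le v)⟩,
    ⟨Nat.find_spec hex, fun j hj => Nat.find_min hex hj⟩, hu⟩

/-- The neighbour behind the first port that leads to a node of the other colour. -/
noncomputable def partner (v : Fin I.n) : Fin I.n := (I.exists_selects v).choose

theorem adj_partner (v : Fin I.n) : I.G.Adj v (I.partner v) :=
  (I.exists_selects v).choose_spec.1

theorem color_partner_ne (v : Fin I.n) : I.c (I.partner v) ≠ I.c v :=
  (I.exists_selects v).choose_spec.2.1

theorem tail_partner (v : Fin I.n) :
    ∃ k : Fin Δ, I.Selects v k ∧ I.p.tail v k = some (I.partner v) :=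
  (I.exists_selects v).choose_spec.2.2

/-- This makes "selected by a node satisfying P" local: through port j, `v` hears from `u` the index
of the port that `u` selects, and compares it with the number of the port of `u` behind j. -/
theorem exists_partner_eq_iff (P : Fin I.n → Prop) (v : Fin I.n) :
    (∃ u, P u ∧ I.partner u = v) ↔ ∃ j k : Fin Δ, I.p.num v j = some ((k : ℕ) + 1) ∧
      ∃ u, I.p.tail v j = some u ∧ P u ∧ I.Selects u k := by
  constructor
  · rintro ⟨u, hu, rfl⟩
    obtain ⟨k, hk, ht⟩ := I.tail_partner u
    obtain ⟨-, -, j, hj, hj1, -, hj3⟩ := I.tail_eq_some ht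
    exact ⟨⟨j, hj.trans_le (I.degree_le _)⟩, k, hj3, u, hj1, hu, hk⟩
  · rintro ⟨j, k, hn, u, ht, hu, hk⟩
    obtain ⟨-, -, k', -, hk1, hk2, -⟩ := I.tail_eq_some ht
    have : k' = k := by simpa [hk2] using hn
    subst this
    obtain ⟨l, hl, hl'⟩ := I.tail_partner u
    rw [← hk.unique hl, hk1] at hl'
    exact ⟨u, hu, (Option.some.inj hl').symm⟩

end Input

namespace NodePred.Computable

variable {Δ : ℕ}

theorem opposite (i : Fin Δ) : Computable (Δ := Δ) fun I v => I.Opposite v i := by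
  convert (color_eq_one.and (pull i color_eq_one.not)).or
    (color_eq_one.not.and (pull i color_eq_one)) using 3 with I v
  unfold Input.Opposite
  generalize I.p.tail v i = t
  cases t with
  | none => simp
  | some u =>
    simp only [Option.some.injEq, exists_eq_left']
    generalize I.c v = a
    generalize I.c u = b
    revert a b
    decide

theorem selects (i : Fin Δ) : Computable (Δ := Δ) fun I v => I.Selects v i := by
  convert (opposite i).and (exists_mem (Finset.univ.filter (· < i)) opposite).not using 3 with I v
  simp only [Input.Selects, Finset.mem_filter, Finset.mem_univ, true_and, not_exists, not_and]
  refine and_congr_right fun _ => ⟨fun h j hj => h j hj, fun h j hj => ?_⟩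
  exact h ⟨j, hj.trans i.2⟩ hj

theorem exists_partner_eq {P : NodePred Δ} (hP : Computable P) :
    Computable fun I v => ∃ u, P I u ∧ I.partner u = v := by
  simp only [Input.exists_partner_eq_iff]
  exact exists_fintype fun j => exists_fintype fun k =>
    (num_eq j k).and (pull j (hP.and (selects k)))

end NodePred.Computable

/-! ### A dominating set with at most half of the nodes -/

section Partner

variable {V : Type*} (c : V → Fin 2) (f : V → V)

/-- Nodes of colour `0` that are selected by a node of colour `1` that nobody selects. -/
def IsInnerCenter (v : V) : Prop :=
  ¬ c v = 1 ∧ ∃ u, (c u = 1 ∧ ¬ ∃ w, ¬ c w = 1 ∧ f w = u) ∧ f u = v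

/-- The centres of a covering by disjoint stars, for a selection `f` of neighbours of the other
colour. -/
def IsCenter (v : V) : Prop :=
  IsInnerCenter c f v ∨ (c v = 1 ∧ ∃ w, (¬ c w = 1 ∧ ¬ IsInnerCenter c f w) ∧ f w = v)

variable {c f}

/-- An inner centre is selected by a node of colour 1 that no node of colour 0 selects, which
therefore cannot be a centre; a centre of colour 1 is selected by a node of colour 0 that is not an
inner centre. -/
theorem exists_not_isCenter_of_isCenter {v : V} (hv : IsCenter c f v) :
    ∃ u, ¬ IsCenter c f u ∧ f u = v := by
  rcases hv with ⟨-, u, ⟨hu, hn⟩, rfl⟩ | ⟨-, w, ⟨hw, hn⟩, rfl⟩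
  · refine ⟨u, ?_, rfl⟩
    rintro (h | ⟨-, w, hw, hwu⟩)
    · exact h.1 hu
    · exact hn ⟨w, hw.1, hwu⟩
  · refine ⟨w, ?_, rfl⟩
    rintro (h | h)
    · exact hn h
    · exact hw h.1

theorem isCenter_or_exists {G : SimpleGraph V} (hadj : ∀ v, G.Adj v (f v))
    (hc : ∀ v, c (f v) ≠ c v) (v : V) :
    IsCenter c f v ∨ ∃ u, IsCenter c f u ∧ G.Adj v u := by
  by_cases hv : c v = 1
  · by_cases hp : ∃ w, ¬ c w = 1 ∧ f w = v
    · obtain ⟨w, hw, rfl⟩ := hp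
      by_cases hi : IsInnerCenter c f w
      · exact Or.inr ⟨w, Or.inl hi, (hadj w).symm⟩
      · exact Or.inl (Or.inr ⟨hv, w, ⟨hw, hi⟩, rfl⟩)
    -- An unselected node of colour 1 turns its own partner into an inner centre.
    · exact Or.inr ⟨f v, Or.inl ⟨fun h => hc v (h.trans hv.symm), v, ⟨hv, hp⟩, rfl⟩, hadj v⟩
  · by_cases hi : IsInnerCenter c f v
    · exact Or.inl (Or.inl hi)
    · have h1 : c (f v) = 1 := by
        have := hc v
        revert this hv
        generalize c v = a
        generalize c (f v) = b
        revert a b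
        decide
      exact Or.inr ⟨f v, Or.inr ⟨h1, v, ⟨hv, hi⟩, rfl⟩, hadj v⟩

theorem two_mul_card_le_of_isCenter [Fintype V] (D : Finset V)
    (hD : ∀ v, v ∈ D ↔ IsCenter c f v) : 2 * D.card ≤ Fintype.card V := by
  classical
  have h : D.card ≤ Dᶜ.card := by
    -- D is contained in the image of its complement under `f`.
    refine (Finset.card_le_card ?_).trans (Finset.card_image_le (s := Dᶜ) (f := f))
    intro v hv
    obtain ⟨u, hu, rfl⟩ := exists_not_isCenter_of_isCenter ((hD v).1 hv)
    exact Finset.mem_image_of_mem f (by simpa [hD] using hu)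
  have := D.card_add_card_compl
  omega

end Partner

theorem isCenter_computable (Δ : ℕ) :
    NodePred.Computable (Δ := Δ) fun I v => IsCenter I.c I.partner v := by
  have h1 := NodePred.Computable.color_eq_one (Δ := Δ)
  have hin : NodePred.Computable (Δ := Δ) fun I v => IsInnerCenter I.c I.partner v :=
    h1.not.and (h1.and h1.not.exists_partner_eq.not).exists_partner_eq
  exact hin.or (h1.and (h1.not.and hin.not).exists_partner_eq)

/-! ### Bounds on the domination number -/

section Domination

variable {V : Type*} {G : SimpleGraph V}

theorem dominationNumber_le {D : Finset V} (hD : IsDominating G D) :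
    dominationNumber G ≤ D.card :=
  Nat.sInf_le ⟨D, hD, rfl⟩

theorem exists_isDominating_card_eq [Fintype V] (G : SimpleGraph V) :
    ∃ D : Finset V, IsDominating G D ∧ D.card = dominationNumber G :=
  Nat.sInf_mem (s := {k : ℕ | ∃ D : Finset V, IsDominating G D ∧ D.card = k})
    ⟨_, Finset.univ, fun v => Or.inl (Finset.mem_univ v), rfl⟩

theorem card_le_mul_dominationNumber [Fintype V] [DecidableRel G.Adj] {Δ : ℕ} (hG : ∀ v, G.degree v ≤ Δ) :
    Fintype.card V ≤ dominationNumber G * (Δ + 1) := by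
  classical
  obtain ⟨D, hD, hcard⟩ := exists_isDominating_card_eq G
  have hcover : (Finset.univ : Finset V) ⊆ D.biUnion fun u => insert u (G.neighborFinset u) := by
    intro v _
    rw [Finset.mem_biUnion]
    rcases hD v with hv | ⟨u, hu, hadj⟩
    · exact ⟨v, hv, Finset.mem_insert_self _ _⟩
    · exact ⟨u, hu, Finset.mem_insert_of_mem (by simpa using hadj.symm)⟩
  rw [← hcard, ← Finset.card_univ]
  refine (Finset.card_le_card hcover).trans (Finset.card_biUnion_le_card_mul _ _ _ fun u _ => ?_)
  refine (Finset.card_insert_le _ _).trans ?_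
  rw [SimpleGraph.card_neighborFinset_eq_degree]
  exact Nat.add_le_add_right (hG u) 1

end Domination

/-! ### The upper bound -/

theorem canApproxMDS_half (Δ : ℕ) : CanApproxMDS Δ (((Δ : ℝ) + 1) / 2) := by
  obtain ⟨θ, hθ⟩ := (isCenter_computable Δ).exists_label
  refine ⟨θ, fun n G _ hG p c hc => ?_⟩
  let I : Input Δ := ⟨n, G, inferInstance, hG, p, c, hc⟩
  have hmem (v : Fin n) : v ∈ (Finset.univ.filter fun v => θ.label p (feature Δ G c) v = 1) ↔
      IsCenter c I.partner v := by
    simpa using hθ I v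
  generalize (Finset.univ.filter fun v => θ.label p (feature Δ G c) v = 1) = D at hmem
  constructor
  · intro v
    simp only [hmem]
    exact isCenter_or_exists I.adj_partner I.color_partner_ne v
  · have h1 := two_mul_card_le_of_isCenter D hmem
    have h2 := h1.trans (card_le_mul_dominationNumber hG)
    have h3 : (2 : ℝ) * D.card ≤ dominationNumber G * (Δ + 1) := by exact_mod_cast h2
    linarith

/-! ### Symmetric port numberings -/

section Symmetric

variable {V : Type*} [Fintype V] {G : SimpleGraph V} [DecidableRel G.Adj]

/-- If every port leads to a port with the same number, at a node of the other colour, then the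
embeddings depend on the colour only. -/
theorem Layers.eval_eq_of_color_eq {Δ d : ℕ} (hG : ∀ v, G.degree v = d)
    (p : ConsistentPortNumbering G) (c : V → Fin 2)
    (hp : ∀ q, ((p.toFun q).2 : ℕ) = q.2 ∧ c (p.toFun q).1 ≠ c q.1)
    {m e : ℕ} (L : Layers Δ m e) (z : V → Fin m → ℝ) (hz : ∀ u v, c u = c v → z u = z v)
    {u v : V} (huv : c u = c v) : L.eval p z u = L.eval p z v := by
  induction L with
  | nil => exact hz u v huv
  | cons W rest ih =>
    refine ih _ fun u v huv => ?_
    have hconcat : concat p Δ z u = concat p Δ z v := by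
      funext k
      rcases k with k | ⟨i, k | k⟩
      · exact congrFun (hz u v huv) k
      · simp only [concat, ConsistentPortNumbering.tail, ConsistentPortNumbering.source, hG]
        split_ifs with hi
        · simp only [Option.map_some, Option.elim_some]
          refine congrFun (hz _ _ ?_) k
          have hu := (hp ⟨u, ⟨i, by rwa [hG]⟩⟩).2
          have hv := (hp ⟨v, ⟨i, by rwa [hG]⟩⟩).2
          simp only at hu hv
          rw [← huv] at hv
          generalize c (p.toFun ⟨u, ⟨i, _⟩⟩).1 = a at *
          generalize c (p.toFun ⟨v, ⟨i, _⟩⟩).1 = b at *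
          generalize c u = x at *
          -- Both colours differ from the same element of `Fin 2`, so they agree.
          omega
        · rfl
      · simp only [concat, ConsistentPortNumbering.num, ConsistentPortNumbering.source, hG]
        split_ifs with hi
        · simp [(hp ⟨u, ⟨i, by rwa [hG]⟩⟩).1, (hp ⟨v, ⟨i, by rwa [hG]⟩⟩).1]
        · rfl
    simp only [hconcat]

/-- Regularity makes the degree part of the features constant, so the initial features depend on the
colour only. -/
theorem CPNGNN.label_eq_of_color_eq {Δ d k : ℕ} (θ : CPNGNN Δ (Δ + 1 + 1) k)
    (hG : ∀ v, G.degree v = d) (p : ConsistentPortNumbering G) (c : V → Fin 2)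
    (hp : ∀ q, ((p.toFun q).2 : ℕ) = q.2 ∧ c (p.toFun q).1 ≠ c q.1) {u v : V} (huv : c u = c v) :
    θ.label p (feature Δ G c) u = θ.label p (feature Δ G c) v := by
  unfold CPNGNN.label
  rw [Layers.eval_eq_of_color_eq hG p c hp θ.layers _ _ huv]
  intro u v huv
  simp [feature, hG, huv]

end Symmetric

/-! ### The complete bipartite graph without a perfect matching -/

/-- The numbering of the nodes of the crown graph by side and position. -/
def crownEquiv (Δ : ℕ) : Fin (2 * (Δ + 1)) ≃ Fin 2 × Fin (Δ + 1) := finProdFinEquiv.symm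

/-- The complete bipartite graph on `(Δ + 1) + (Δ + 1)` nodes without a perfect matching. -/
def crown (Δ : ℕ) : SimpleGraph (Fin (2 * (Δ + 1))) where
  Adj u v := (crownEquiv Δ u).1 ≠ (crownEquiv Δ v).1 ∧ (crownEquiv Δ u).2 ≠ (crownEquiv Δ v).2
  symm := ⟨fun _ _ h => ⟨h.1.symm, h.2.symm⟩⟩
  loopless := ⟨fun _ h => h.1 rfl⟩

instance (Δ : ℕ) : DecidableRel (crown Δ).Adj := fun _ _ => instDecidableAnd

/-- The node that is `k` positions further (on side `0`) or before (on side `1`), on the other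
side. -/
def crownShift (Δ : ℕ) (x : Fin 2 × Fin (Δ + 1)) (k : Fin (Δ + 1)) : Fin 2 × Fin (Δ + 1) :=
  (x.1 + 1, if x.1 = 0 then x.2 + k else x.2 - k)

theorem crownShift_crownShift (Δ : ℕ) (x : Fin 2 × Fin (Δ + 1)) (k : Fin (Δ + 1)) :
    crownShift Δ (crownShift Δ x k) k = x := by
  obtain ⟨a, b⟩ := x
  fin_cases a <;> simp [crownShift]

/-- Port index i stands for the shift i+1; shift 0 would be the removed matching edge. -/
theorem exists_crownShift_eq {Δ : ℕ} {x y : Fin 2 × Fin (Δ + 1)} (h1 : x.1 ≠ y.1)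
    (h2 : x.2 ≠ y.2) : ∃ i : Fin Δ, crownShift Δ x i.succ = y := by
  have h : ∃ k : Fin (Δ + 1), k ≠ 0 ∧ crownShift Δ x k = y := by
    obtain ⟨a, b⟩ := x
    obtain ⟨a', b'⟩ := y
    fin_cases a <;> fin_cases a' <;> simp at h1 h2
    · exact ⟨b' - b, sub_ne_zero.2 (Ne.symm h2), by simp [crownShift]⟩
    · exact ⟨b - b', sub_ne_zero.2 h2, by simp [crownShift]⟩
  obtain ⟨k, hk, h⟩ := h
  obtain ⟨i, rfl⟩ := Fin.exists_succ_eq.2 hk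
  exact ⟨i, h⟩

theorem crown_degree (Δ : ℕ) (v : Fin (2 * (Δ + 1))) : (crown Δ).degree v = Δ := by
  have h : (crown Δ).neighborFinset v = (Finset.univ.erase (crownEquiv Δ v).2).image
      fun b => (crownEquiv Δ).symm ((crownEquiv Δ v).1 + 1, b) := by
    ext u
    obtain ⟨⟨a, b⟩, rfl⟩ := (crownEquiv Δ).symm.surjective u
    rw [SimpleGraph.mem_neighborFinset]
    change (_ ≠ _ ∧ _ ≠ _) ↔ _
    simp only [Finset.mem_image, Finset.mem_erase, Finset.mem_univ, and_true, Equiv.apply_symm_apply,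
      EmbeddingLike.apply_eq_iff_eq, Prod.mk.injEq]
    generalize crownEquiv Δ v = x
    have h2 : x.1 ≠ a ↔ x.1 + 1 = a := by
      generalize x.1 = y
      revert y a
      decide
    constructor
    · rintro ⟨h, h'⟩
      exact ⟨b, h'.symm, h2.1 h, rfl⟩
    · rintro ⟨b', h, h', rfl⟩
      exact ⟨h2.2 h', h.symm⟩
  rw [← SimpleGraph.card_neighborFinset_eq_degree, h,
    Finset.card_image_of_injective _ fun a b hab => by simpa using hab,
    Finset.card_erase_of_mem (Finset.mem_univ _)]
  simp

/-- The port numbering of the crown graph given by the shifts. -/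
def crownPorts (Δ : ℕ) : ConsistentPortNumbering (crown Δ) where
  toFun q := ⟨(crownEquiv Δ).symm
    (crownShift Δ (crownEquiv Δ q.1) (q.2.cast (crown_degree Δ q.1)).succ),
    q.2.cast ((crown_degree Δ _).trans (crown_degree Δ _).symm)⟩
  edge u v h := by
    obtain ⟨i, hi⟩ := exists_crownShift_eq h.1 h.2
    refine ⟨i.cast (crown_degree Δ u).symm, i.cast (crown_degree Δ v).symm, ?_⟩
    have hv : (crownEquiv Δ).symm (crownShift Δ (crownEquiv Δ u) i.succ) = v := by
      rw [hi, Equiv.symm_apply_apply]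
    subst hv
    rfl
  consistent q := by
    obtain ⟨v, i⟩ := q
    -- The `Fin` type of a port number depends on the node, so equality of ports is reduced to
    -- equality of nodes and of numerical values.
    have h (w : Fin (2 * (Δ + 1))) (hw : w = v) (j : Fin ((crown Δ).degree w))
        (hj : (j : ℕ) = i) : (⟨w, j⟩ : Port (crown Δ)) = ⟨v, i⟩ := by
      subst hw
      rw [Fin.ext hj]
    refine h _ ?_ _ rfl
    simp [crownShift_crownShift]

/-- The colouring of the crown graph by the sides. -/
def crownColor (Δ : ℕ) (v : Fin (2 * (Δ + 1))) : Fin 2 := (crownEquiv Δ v).1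

theorem crownPorts_symmetric (Δ : ℕ) (q : Port (crown Δ)) :
    (((crownPorts Δ).toFun q).2 : ℕ) = q.2 ∧
      crownColor Δ ((crownPorts Δ).toFun q).1 ≠ crownColor Δ q.1 := by
  refine ⟨rfl, ?_⟩
  simp only [crownPorts, crownColor, Equiv.apply_symm_apply, crownShift]
  generalize (crownEquiv Δ q.1).1 = a
  revert a
  decide

theorem crown_isWeakTwoColoring {Δ : ℕ} (hΔ : 1 ≤ Δ) :
    IsWeakTwoColoring (crown Δ) (crownColor Δ) := by
  intro v
  have hi : 0 < (crown Δ).degree v := by rw [crown_degree]; exact hΔ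
  exact ⟨_, (crownPorts Δ).adj v ⟨0, hi⟩,
    (crownPorts_symmetric Δ ⟨v, ⟨0, hi⟩⟩).2.symm⟩

/-- The two ends of one removed matching edge dominate: each is adjacent to all of the opposite side
except the other. -/
theorem dominationNumber_crown_le (Δ : ℕ) : dominationNumber (crown Δ) ≤ 2 := by
  refine (dominationNumber_le
    (D := {(crownEquiv Δ).symm (0, 0), (crownEquiv Δ).symm (1, 0)}) ?_).trans
      Finset.card_le_two
  intro v
  obtain ⟨⟨a, b⟩, rfl⟩ := (crownEquiv Δ).symm.surjective v
  by_cases hb : b = 0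
  · subst hb
    left
    fin_cases a <;> simp
  · right
    fin_cases a
    · exact ⟨(crownEquiv Δ).symm (1, 0), by simp, by simp [crown, hb]⟩
    · exact ⟨(crownEquiv Δ).symm (0, 0), by simp, by simp [crown, hb]⟩

/-- A nonempty set of nodes of the crown graph that is a union of sides contains a whole side. -/
theorem le_card_of_color_invariant {Δ : ℕ} {D : Finset (Fin (2 * (Δ + 1)))} (hD : D.Nonempty)
    (hc : ∀ u v, crownColor Δ u = crownColor Δ v → u ∈ D → v ∈ D) : Δ + 1 ≤ D.card := by
  obtain ⟨u, hu⟩ := hD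
  have hinj : Function.Injective fun b => (crownEquiv Δ).symm (crownColor Δ u, b) :=
    fun a b hab => by simpa using hab
  calc Δ + 1 = (Finset.univ.map ⟨_, hinj⟩).card := by simp
    _ ≤ D.card := Finset.card_le_card fun v hv => by
      obtain ⟨b, -, rfl⟩ := Finset.mem_map.1 hv
      exact hc u _ (by simp [crownColor]) hu

/-! ### The lower bound -/

theorem not_canApproxMDS {Δ : ℕ} (hΔ : 1 ≤ Δ) {α : ℝ} (hα : α < ((Δ : ℝ) + 1) / 2) :
    ¬ CanApproxMDS Δ α := by
  rintro ⟨θ, h⟩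
  obtain ⟨hdom, hcard⟩ := h _ (crown Δ) (fun v => (crown_degree Δ v).le) (crownPorts Δ)
    (crownColor Δ) (crown_isWeakTwoColoring hΔ)
  have hlab (u v) (huv : crownColor Δ u = crownColor Δ v) :=
    θ.label_eq_of_color_eq (crown_degree Δ) (crownPorts Δ) (crownColor Δ)
      (crownPorts_symmetric Δ) huv
  have hinv := le_card_of_color_invariant (Δ := Δ)
    (D := Finset.univ.filter fun v =>
      θ.label (crownPorts Δ) (feature Δ (crown Δ) (crownColor Δ)) v = 1)
    (by
      rcases hdom ((crownEquiv Δ).symm (0, 0)) with h0 | ⟨u, hu, -⟩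
      · exact ⟨_, h0⟩
      · exact ⟨u, hu⟩)
    (fun u v huv hu => by
      simp only [Finset.mem_filter, Finset.mem_univ, true_and] at hu ⊢
      rwa [← hlab u v huv])
  have h1 : ((Δ : ℝ) + 1) ≤ α * dominationNumber (crown Δ) :=
    le_trans (by exact_mod_cast hinv) hcard
  have h2 : (dominationNumber (crown Δ) : ℝ) ≤ 2 := by
    exact_mod_cast dominationNumber_crown_le Δ
  have h3 : (0 : ℝ) ≤ dominationNumber (crown Δ) := Nat.cast_nonneg _
  have h4 : (0 : ℝ) ≤ Δ := Nat.cast_nonneg _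
  -- γ ≤ 2 bounds αγ from above only for α ≥ 0; otherwise αγ ≤ 0 < Δ+1.
  rcases le_total 0 α with h5 | h5
  · linarith [mul_le_mul_of_nonneg_left h2 h5]
  · linarith [mul_nonpos_of_nonpos_of_nonneg h5 h3]

end GNN

theorem theorem5 (Δ : ℕ) (hΔ : 1 ≤ Δ) :
    GNN.CanApproxMDS Δ (((Δ : ℝ) + 1) / 2) ∧
      ∀ α : ℝ, α < ((Δ : ℝ) + 1) / 2 → ¬ GNN.CanApproxMDS Δ α :=
  ⟨GNN.canApproxMDS_half Δ, fun _ hα => GNN.not_canApproxMDS hΔ hα⟩
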